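/- Let $C^2(\mathbb R^p)$ be the space of twice continuously differentiable functions $\mathbb R^p\to\mathbb R$ with the topology of uniform convergence on compact sets of the function and of its first and second partial derivatives. Adjoin to $\mathbb R^p$ and to $\mathbb R^{p\times p}$ an isolated point NaO ("not an object"), which propagates through all operations. The one-step Newton map is $G(q,\delta)=\delta+(-\nabla^2q(\delta))^{-1}\nabla q(\delta)$ when $-\nabla^2 q(\delta)$ is positive definite, and $G(q,\delta)=\mathrm{NaO}$ otherwise. Let $q(\delta)=\delta'Z-\tfrac12\,\delta'K\delta$ be the log likelihood of an LAMN model. That is, $(P_\delta)_{\delta\in\mathbb R^p}$ is a family of probability measures having almost everywhere positive densities $f_\delta$ with respect to some measure, $Z$ is a random $p$-vector, $K$ is a random $p\times p$ matrix, $q(\delta)-\log f_\delta$ almost everywhere does not depend on $\delta$, $K$ is almost surely symmetric positive definite, and the distribution of $K$ under $P_\delta$ does not depend on $\delta$. Suppose that $q_n$ are random elements of $C^2(\mathbb R^p)$ and $\tilde\delta_n$ random elements of $\mathbb R^p$ such that $$(q_n,\tilde\delta_n)\Rightarrow(q,\tilde\delta)\quad\text{in } C^2(\mathbb R^p)\times\mathbb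 R^p, \tag{1}$$ where $\Rightarrow$ is convergence in law and the law of $(q,\tilde\delta)$ is taken under $P_0$ (true parameter value zero). Let $\hat\delta_n=G(q_n,\tilde\delta_n)$. Then $$-\nabla^2 q_n(\tilde\delta_n)\Rightarrow K,\qquad -\nabla^2 q_n(\hat\delta_n)\Rightarrow K,\qquad \hat\delta_n\Rightarrow K^{-1}Z,\qquad \bigl(-\nabla^2 q_n(\hat\delta_n)\bigr)^{1/2}\hat\delta_n\Rightarrow N(0,I),$$ where the matrix square root is the symmetric square root when the matrix is positive definite and NaO otherwise. Moreover these four convergences and (1) hold jointly: the vector of all the left hand sides converges in law to $(q,\tilde\delta,K,K,K^{-1}Z,K^{-1/2}Z)$ under $P_0$, where $K^{-1/2}Z$ has distribution $N(0,I)$. -/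

import Mathlib

open MeasureTheory ProbabilityTheory Filter
open scoped Topology MatrixOrder

noncomputable section

/-- The parameter space `ℝᵖ` with its Euclidean structure. -/
abbrev Vec (p : ℕ) : Type := EuclideanSpace ℝ (Fin p)

/-- Real `p × p` matrices. -/
abbrev Mat (p : ℕ) : Type := Matrix (Fin p) (Fin p) ℝ

/-- Matrices carry the entrywise (product) σ-algebra, which is the Borel one. -/
instance Mat.instMeasurableSpace (p : ℕ) : MeasurableSpace (Mat p) :=
  inferInstanceAs (MeasurableSpace (Fin p → Fin p → ℝ))

instance Mat.instBorelSpace (p : ℕ) : BorelSpace (Mat p) :=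
  inferInstanceAs (BorelSpace (Fin p → Fin p → ℝ))

instance Mat.instSecondCountableTopology (p : ℕ) : SecondCountableTopology (Mat p) :=
  inferInstanceAs (SecondCountableTopology (Fin p → Fin p → ℝ))

/-- Multiplication of a Euclidean vector by a matrix. -/
def Mat.apply {p : ℕ} (A : Mat p) (v : Vec p) : Vec p := WithLp.toLp 2 (A.mulVec v.ofLp)

/-! ### The space of twice continuously differentiable functions -/

/-- The Hessian matrix of second partial derivatives `∂ᵢ∂ⱼ f (x)`. -/
def hessianMatrix {p : ℕ} (f : Vec p → ℝ) (x : Vec p) : Mat p :=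
  Matrix.of fun i j =>
    fderiv ℝ (fun y => fderiv ℝ f y (EuclideanSpace.single j 1)) x (EuclideanSpace.single i 1)

/-- `C²(ℝᵖ)`: the twice continuously differentiable functions `ℝᵖ → ℝ`. -/
structure C2 (p : ℕ) where
  toFun : Vec p → ℝ
  contDiff : ContDiff ℝ 2 toFun

namespace C2

variable {p : ℕ}

/-- The gradient of `f` at `x`. -/
def grad (f : C2 p) (x : Vec p) : Vec p := gradient f.toFun x

/-- The Hessian matrix of `f` at `x`. -/
def hess (f : C2 p) (x : Vec p) : Mat p := hessianMatrix f.toFun x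

theorem continuous_grad (f : C2 p) : Continuous f.grad :=
  (InnerProductSpace.toDual ℝ (Vec p)).symm.continuous.comp
    (f.contDiff.continuous_fderiv (by norm_num))

theorem continuous_hess (f : C2 p) : Continuous f.hess := by
  refine continuous_matrix fun i j => ?_
  have h1 : ContDiff ℝ 1 (fun y => fderiv ℝ f.toFun y (EuclideanSpace.single j (1 : ℝ))) :=
    (f.contDiff.fderiv_right (m := 1) (by norm_num)).clm_apply contDiff_const
  exact (h1.continuous_fderiv (by norm_num)).clm_apply continuous_const

/-- A function together with its first and second partial derivatives, as continuous maps. -/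
def jet (f : C2 p) : C(Vec p, ℝ) × C(Vec p, Vec p) × C(Vec p, Mat p) :=
  (⟨f.toFun, f.contDiff.continuous⟩, ⟨f.grad, f.continuous_grad⟩, ⟨f.hess, f.continuous_hess⟩)

/-- The topology of uniform convergence on compact sets of the function and of its first and
second partial derivatives (the topology on `C(·, ·)` is the compact-open one). -/
instance instTopologicalSpace : TopologicalSpace (C2 p) :=
  TopologicalSpace.induced jet inferInstance

instance instSecondCountableTopology : SecondCountableTopology (C2 p) :=
  TopologicalSpace.secondCountableTopology_induced _ _ jet

/-- Random elements of `C²(ℝᵖ)` are Borel measurable maps. -/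
instance instMeasurableSpace : MeasurableSpace (C2 p) := borel _

instance instBorelSpace : BorelSpace (C2 p) := ⟨rfl⟩

/-- The quadratic function `δ ↦ δ' z - ½ δ' K δ`. -/
def quadratic (z : Vec p) (K : Mat p) : C2 p where
  toFun δ := inner ℝ δ z - 1 / 2 * inner ℝ δ (K.apply δ)
  contDiff := by
    have hK : ContDiff ℝ 2 (fun δ : Vec p => K.apply δ) :=
      (Matrix.toEuclideanLin K).toContinuousLinearMap.contDiff
    exact (contDiff_id.inner ℝ contDiff_const).sub
      (contDiff_const.mul (contDiff_id.inner ℝ hK))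

end C2

/-! ### Adjoining the value NaO ("not an object") as an isolated point -/

/-- The space `X` with one additional isolated point. -/
abbrev NaO (X : Type*) : Type _ := X ⊕ Unit

namespace NaO

/-- A genuine element of `X`. -/
abbrev obj {X : Type*} (x : X) : NaO X := Sum.inl x

/-- The value NaO. -/
abbrev nao {X : Type*} : NaO X := Sum.inr ()

/-- Apply a partially defined operation; NaO propagates. -/
def bind {X Y : Type*} (f : X → NaO Y) : NaO X → NaO Y
  | Sum.inl x => f x
  | Sum.inr _ => nao

instance instBorelSpace {X : Type*} [TopologicalSpace X] [MeasurableSpace X] [BorelSpace X] :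
    BorelSpace (NaO X) := by
  constructor
  apply le_antisymm
  · intro s hs
    obtain ⟨h1, -⟩ := measurableSet_sum_iff.mp hs
    let _ : MeasurableSpace (NaO X) := borel _
    have _ : BorelSpace (NaO X) := ⟨rfl⟩
    rw [← Set.image_preimage_inl_union_image_preimage_inr s]
    refine MeasurableSet.union ?_ ?_
    · exact (Topology.IsOpenEmbedding.inl.measurableEmbedding).measurableSet_image.mpr h1
    · exact (Topology.IsOpenEmbedding.inr.isOpenMap _ (isOpen_discrete _)).measurableSet
  · refine MeasurableSpace.generateFrom_le fun s hs => ?_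
    have h := isOpen_sum_iff.mp hs
    exact measurableSet_sum_iff.mpr ⟨h.1.measurableSet, trivial⟩

end NaO

variable {p : ℕ}

open Classical in
/-- The one-step Newton map `G(q, δ) = δ + (-∇²q(δ))⁻¹ ∇q(δ)`, defined when `-∇²q(δ)` is positive
definite, and NaO otherwise. -/
def newtonStep (q : C2 p) : NaO (Vec p) → NaO (Vec p) :=
  NaO.bind fun δ =>
    if (-q.hess δ).PosDef then NaO.obj (δ + ((-q.hess δ)⁻¹ : Mat p).apply (q.grad δ)) else NaO.nao

/-- The observed information `-∇²q(δ)`, which is NaO when `δ` is. -/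
def obsInfo (q : C2 p) : NaO (Vec p) → NaO (Mat p) :=
  NaO.bind fun δ => NaO.obj (-q.hess δ)

open Classical in
/-- The symmetric square root of a positive definite matrix, and NaO for any other argument. -/
def sqrtNaO : NaO (Mat p) → NaO (Mat p) :=
  NaO.bind fun A => if A.PosDef then NaO.obj (CFC.sqrt A) else NaO.nao

/-- Matrix-vector multiplication; NaO propagates. -/
def applyNaO (A : NaO (Mat p)) (v : NaO (Vec p)) : NaO (Vec p) :=
  A.bind fun B => v.bind fun w => NaO.obj (B.apply w)

/-- `K ^ (-1/2) z`. -/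
def invSqrtApply (K : Mat p) (z : Vec p) : Vec p := ((CFC.sqrt K)⁻¹ : Mat p).apply z

set_option synthInstance.maxSize 4000 in
/-- The product σ-algebra on the space of the joint limit is the Borel σ-algebra. -/
instance joint_instBorelSpace (p : ℕ) :
    BorelSpace (C2 p × Vec p × Mat p × NaO (Mat p) × NaO (Vec p) × NaO (Vec p)) :=
  inferInstance

/-! ### Log likelihoods and LAMN models -/

/-- `l` is a log likelihood of the family `P` of probability measures: with respect to some
dominating measure `lam` the family has almost everywhere positive densities `f θ`, and
`l θ = u + log (f θ)`, where `u` does not depend on the parameter. -/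
def IsLogLikelihood {Θ Ω : Type*} [MeasurableSpace Ω] (P : Θ → Measure Ω) (l : Θ → Ω → ℝ) :
    Prop :=
  ∃ (lam : Measure Ω) (f : Θ → Ω → ℝ) (u : Ω → ℝ), ∀ θ,
    Measurable (f θ) ∧ (∀ᵐ ω ∂lam, 0 < f θ ω) ∧
    P θ = lam.withDensity (fun ω => ENNReal.ofReal (f θ ω)) ∧
    ∀ᵐ ω ∂lam, l θ ω = u ω + Real.log (f θ ω)

/-- The family `P`, with parameter space `ℝᵖ`, is an LAMN model with log likelihood
`q(δ) = δ' Z - ½ δ' K δ`: the observed information `K` is almost surely positive definite and its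
distribution does not depend on the parameter. -/
structure IsLAMN {Ω : Type*} [MeasurableSpace Ω] (P : Vec p → Measure Ω)
    (Z : Ω → Vec p) (K : Ω → Mat p) : Prop where
  isProbabilityMeasure : ∀ δ, IsProbabilityMeasure (P δ)
  measurable_Z : Measurable Z
  measurable_K : Measurable K
  isLogLikelihood : IsLogLikelihood P (fun δ ω => (C2.quadratic (Z ω) (K ω)).toFun δ)
  map_K_eq : ∀ δ δ', (P δ).map K = (P δ').map K
  posDef : ∀ δ, ∀ᵐ ω ∂(P δ), (K ω).PosDef

end

/-! Newton's method is exact on a quadratic. If `K` is positive definite, the gradient of `q` at `δ`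
is `Z - K δ` and minus its Hessian is `K`, so one step lands on `K⁻¹ Z` from any starting point
(`newtonUpdate_quadratic`). All the left hand sides are images of `(qₙ, δₙ)` under one fixed map.
That map is continuous on `newtonDomain₂`, where the information is positive definite before and
after the step. This set is open, because Hessians are symmetric and positivity of a quadratic form
on the unit sphere is an open condition. The limit `(q, δ)` lies in it almost surely, so the mapping
theorem gives joint convergence.

Normality of `K^(-1/2) Z` comes from the model alone. The likelihood ratio of `P δ` to `P 0` is
`exp(δ'Z - ½ δ'Kδ)`, and the law of `K` is the same under both. Integrating functions of `K`
therefore shows that, on each event determined by `K`, `Z` has the Laplace transform of a mixture of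
`N(0, K)`. Where `K` is bounded this transform is finite and determines the law, by analytic
continuation to the characteristic function. Hence `(K, Z)` has the law of `(K, K^(1/2) W)` with `W`
standard normal and independent of `K` (`IsLAMN.map_prodMk_eq`). -/

/-! ### Convergence in law and measurability for maps continuous on part of the space -/

/-- **Mapping theorem**: convergence in distribution is preserved by a measurable map which is
continuous on an open set carrying the limit. -/
theorem MeasureTheory.TendstoInDistribution.comp_of_continuousOn
    {ι E F Ω' : Type*} {Ω : ι → Type*} {m : ∀ i, MeasurableSpace (Ω i)}
    {μ : ∀ i, Measure (Ω i)} [∀ i, IsProbabilityMeasure (μ i)]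
    {m' : MeasurableSpace Ω'} {μ' : Measure Ω'} [IsProbabilityMeasure μ']
    [TopologicalSpace E] [MeasurableSpace E] [OpensMeasurableSpace E] [HasOuterApproxClosed E]
    [TopologicalSpace F] [MeasurableSpace F] [OpensMeasurableSpace F]
    {l : Filter ι} [l.IsCountablyGenerated] {X : ∀ i, Ω i → E} {Z : Ω' → E}
    (h : TendstoInDistribution X l Z μ μ') {g : E → F} (hg : Measurable g) {U : Set E}
    (hU : IsOpen U) (hgU : ContinuousOn g U) (hZ : ∀ᵐ ω ∂μ', Z ω ∈ U) :
    TendstoInDistribution (fun i ω => g (X i ω)) l (fun ω => g (Z ω)) μ μ' where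
  forall_aemeasurable i := hg.comp_aemeasurable (h.forall_aemeasurable i)
  aemeasurable_limit := hg.comp_aemeasurable h.aemeasurable_limit
  tendsto := by
    refine tendsto_of_forall_isOpen_le_liminf' fun G hG => ?_
    -- Since `U` is open, this set is open in `E` itself, so the portmanteau inequality for open
    -- sets applies; intersecting with `U` loses no mass in the limit.
    have hV : IsOpen (U ∩ g ⁻¹' G) := hgU.isOpen_inter_preimage hU hG
    have h1 := ProbabilityMeasure.le_liminf_measure_open_of_tendsto h.tendsto hV
    simp only [ProbabilityMeasure.coe_mk] at h1 ⊢
    have hgX (i : ι) := hg.comp_aemeasurable (h.forall_aemeasurable i)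
    have hgZ := hg.comp_aemeasurable h.aemeasurable_limit
    simp only [Function.comp_def] at hgX hgZ
    rw [Measure.map_apply_of_aemeasurable h.aemeasurable_limit hV.measurableSet] at h1
    rw [Measure.map_apply_of_aemeasurable hgZ hG.measurableSet]
    calc μ' ((fun ω => g (Z ω)) ⁻¹' G) ≤ μ' (Z ⁻¹' (U ∩ g ⁻¹' G)) := by
          refine measure_mono_ae ?_
          filter_upwards [hZ] with ω hω hG using ⟨hω, hG⟩
      _ ≤ _ := h1
      _ ≤ _ := by
          refine liminf_le_liminf (Eventually.of_forall fun i => ?_)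
          rw [Measure.map_apply_of_aemeasurable (h.forall_aemeasurable i) hV.measurableSet,
            Measure.map_apply_of_aemeasurable (hgX i) hG.measurableSet]
          exact measure_mono fun ω hω => hω.2

theorem measurable_of_continuousOn_of_eqOn_compl {X Y : Type*} [TopologicalSpace X]
    [MeasurableSpace X] [OpensMeasurableSpace X] [TopologicalSpace Y] [MeasurableSpace Y]
    [BorelSpace Y] {f : X → Y} {s : Set X} (hs : MeasurableSet s) (hf : ContinuousOn f s) (c : Y)
    (hc : ∀ x ∉ s, f x = c) : Measurable f := by
  classical
  have h : f = s.piecewise f (fun _ => c) := by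
    ext x
    by_cases hx : x ∈ s <;> simp [hx, hc]
  rw [h]
  exact hf.measurable_piecewise continuousOn_const hs

/-! ### Positive definite matrices, inverses and square roots -/

theorem Mat.continuous_apply : Continuous fun x : Mat p × Vec p => x.1.apply x.2 := by
  unfold Mat.apply
  fun_prop

theorem Mat.apply_mul (A B : Mat p) (v : Vec p) : Mat.apply (A * B) v = A.apply (B.apply v) := by
  simp [Mat.apply, Matrix.mulVec_mulVec]

theorem Mat.one_apply (v : Vec p) : Mat.apply 1 v = v := by
  simp [Mat.apply]

/-- Compactness of the sphere makes positivity stable under perturbation. Symmetry is left out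
because it is not an open condition. -/
theorem Mat.isOpen_forall_quadratic_pos :
    IsOpen {A : Mat p | ∀ x ∈ Metric.sphere (0 : Vec p) 1, 0 < inner ℝ x (A.apply x)} := by
  refine isOpen_iff_mem_nhds.mpr fun A hA => ?_
  refine (isCompact_sphere (0 : Vec p) 1).eventually_forall_of_forall_eventually fun x hx => ?_
  have hc : Continuous fun z : Mat p × Vec p => inner ℝ z.2 (z.1.apply z.2) :=
    continuous_snd.inner Mat.continuous_apply
  exact hc.continuousAt.eventually_const_lt (hA x hx)

theorem Mat.posDef_iff {A : Mat p} : A.PosDef ↔ A.IsHermitian ∧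
    ∀ x ∈ Metric.sphere (0 : Vec p) 1, 0 < inner ℝ x (A.apply x) := by
  have hinner (x : Vec p) : inner ℝ x (A.apply x) = star x.ofLp ⬝ᵥ A.mulVec x.ofLp := by
    rw [Mat.apply, EuclideanSpace.inner_eq_star_dotProduct, dotProduct_comm]
  rw [Matrix.posDef_iff_dotProduct_mulVec]
  refine and_congr_right fun _ => ⟨fun h x hx => ?_, fun h x hx => ?_⟩
  · rw [hinner]
    refine h fun h0 => ?_
    have : x = 0 := (WithLp.ofLp_eq_zero 2).mp h0
    simp [this] at hx
  · have hx' : WithLp.toLp 2 x ≠ (0 : Vec p) := fun h0 => hx ((WithLp.toLp_eq_zero 2).mp h0)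
    have hn : 0 < ‖(WithLp.toLp 2 x : Vec p)‖ := norm_pos_iff.mpr hx'
    have := h (‖(WithLp.toLp 2 x : Vec p)‖⁻¹ • WithLp.toLp 2 x) (by simp [norm_smul, hn.ne'])
    rw [hinner] at this
    simp only [WithLp.ofLp_smul, Matrix.mulVec_smul, dotProduct_smul, smul_dotProduct,
      smul_eq_mul, star_trivial] at this
    have h2 := inv_pos.mpr hn
    simpa [h2] using this

theorem Mat.continuousOn_inv_posDef :
    ContinuousOn (fun A : Mat p => A⁻¹) {A | A.PosDef} := by
  intro A hA
  have hdet : A.det ≠ 0 := hA.det_pos.ne'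
  have : ContinuousAt (fun A : Mat p => A⁻¹) A := by
    simp only [Matrix.inv_def, Ring.inverse_eq_inv']
    exact ContinuousAt.smul ((Continuous.matrix_det continuous_id).continuousAt.inv₀ hdet)
      (Continuous.matrix_adjugate continuous_id).continuousAt
  exact this.continuousWithinAt

open scoped Matrix.Norms.L2Operator in
theorem Mat.continuousOn_sqrt : ContinuousOn (CFC.sqrt : Mat p → Mat p) {A | 0 ≤ A} :=
  CFC.continuousOn_sqrt

/-! ### Laplace transforms -/

/-- Finite measures on a Hilbert space with the same everywhere finite Laplace transform agree. -/
theorem MeasureTheory.Measure.ext_of_lintegral_exp_inner {E : Type*} [NormedAddCommGroup E]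
    [InnerProductSpace ℝ E] [CompleteSpace E] [SecondCountableTopology E] [MeasurableSpace E]
    [BorelSpace E] {μ ν : Measure E} [IsFiniteMeasure μ] [IsFiniteMeasure ν]
    (h : ∀ t, ∫⁻ x, ENNReal.ofReal (Real.exp (inner ℝ t x)) ∂μ =
      ∫⁻ x, ENNReal.ofReal (Real.exp (inner ℝ t x)) ∂ν)
    (hfin : ∀ t, ∫⁻ x, ENNReal.ofReal (Real.exp (inner ℝ t x)) ∂μ ≠ ⊤) : μ = ν := by
  refine Measure.ext_of_charFun (funext fun t => ?_)
  have hmgf : mgf (fun x => inner ℝ t x) μ = mgf (fun x => inner ℝ t x) ν := by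
    ext s
    have hs := h (s • t)
    simp only [real_inner_smul_left] at hs
    unfold mgf
    rw [integral_eq_lintegral_of_nonneg_ae (ae_of_all _ fun _ => (Real.exp_pos _).le)
      (by fun_prop), hs, integral_eq_lintegral_of_nonneg_ae
      (ae_of_all _ fun _ => (Real.exp_pos _).le) (by fun_prop)]
  have hzero : μ = 0 ↔ ν = 0 := by
    have h0 := h 0
    simp only [inner_zero_left, Real.exp_zero, ENNReal.ofReal_one, lintegral_one] at h0
    rw [← Measure.measure_univ_eq_zero, h0, Measure.measure_univ_eq_zero]
  have hset : integrableExpSet (fun x => inner ℝ t x) μ = Set.univ := by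
    refine Set.eq_univ_of_forall fun s => ?_
    have hs := hfin (s • t)
    simp only [real_inner_smul_left] at hs
    refine ⟨by fun_prop, ?_⟩
    rw [hasFiniteIntegral_iff_ofReal (ae_of_all _ fun _ => (Real.exp_pos _).le)]
    exact hs.lt_top
  -- The complex moment generating functions are analytic on the whole plane and agree on the real
  -- line; their value at `I` is the characteristic function at `t`.
  have := eqOn_complexMGF_of_mgf' hmgf hzero (x := Complex.I) (by simp [hset])
  simpa [complexMGF, charFun_apply, real_inner_comm, mul_comm] using this

theorem lintegral_exp_inner_stdGaussian {E : Type*} [NormedAddCommGroup E]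
    [InnerProductSpace ℝ E] [FiniteDimensional ℝ E] [MeasurableSpace E] [BorelSpace E] (t : E) :
    ∫⁻ x, ENNReal.ofReal (Real.exp (inner ℝ t x)) ∂(stdGaussian E) =
      ENNReal.ofReal (Real.exp (‖t‖ ^ 2 / 2)) := by
  have hlaw : (stdGaussian E).map (fun x => inner ℝ t x) = gaussianReal 0 (‖t‖ ^ 2).toNNReal := by
    have h := IsGaussian.map_eq_gaussianReal (μ := stdGaussian E) (innerSL ℝ t)
    rw [integral_strongDual_stdGaussian, variance_dual_stdGaussian, innerSL_apply_norm] at h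
    exact h
  have hint : Integrable (fun x => Real.exp (1 * x)) (gaussianReal 0 (‖t‖ ^ 2).toNNReal) :=
    integrable_exp_mul_gaussianReal 1
  have hm := congrFun (mgf_id_gaussianReal (μ := 0) (v := (‖t‖ ^ 2).toNNReal)) 1
  simp only [mgf, id] at hm
  rw [← lintegral_map (f := fun y : ℝ => ENNReal.ofReal (Real.exp y)) (by fun_prop) (by fun_prop),
    hlaw]
  simp only [one_mul] at hint hm
  rw [← ofReal_integral_eq_lintegral_ofReal hint (ae_of_all _ fun _ => (Real.exp_pos _).le), hm]
  simp

/-! ### Measurability and algebra of the matrix operations -/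

theorem Mat.measurable_inv : Measurable fun A : Mat p => (A⁻¹ : Mat p) := by
  simp only [Matrix.inv_def, Ring.inverse_eq_inv']
  exact (Continuous.matrix_det continuous_id).measurable.inv.smul
    (Continuous.matrix_adjugate continuous_id).measurable

theorem Mat.measurable_sqrt : Measurable (CFC.sqrt : Mat p → Mat p) := by
  have hset : {A : Mat p | 0 ≤ A} = {A | A.IsHermitian} ∩
      ⋂ x : Vec p, {A | 0 ≤ inner ℝ x (A.apply x)} := by
    ext A
    have hinner (x : Vec p) : inner ℝ x (A.apply x) = star x.ofLp ⬝ᵥ A.mulVec x.ofLp := by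
      rw [Mat.apply, EuclideanSpace.inner_eq_star_dotProduct, dotProduct_comm]
    simp only [Set.mem_ofPred_eq, Set.mem_inter_iff, Set.mem_iInter, hinner,
      Matrix.nonneg_iff_posSemidef, Matrix.posSemidef_iff_dotProduct_mulVec]
    exact and_congr_right fun _ => ⟨fun h x => h x.ofLp, fun h x => h (WithLp.toLp 2 x)⟩
  have hclosed : IsClosed {A : Mat p | 0 ≤ A} := by
    rw [hset]
    refine IsClosed.inter
      (isClosed_eq (Continuous.matrix_conjTranspose continuous_id) continuous_id)
      (isClosed_iInter fun x => isClosed_le continuous_const ?_)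
    exact continuous_const.inner
      (Mat.continuous_apply.comp (continuous_id.prodMk continuous_const))
  -- Off the closed cone of positive semidefinite matrices `CFC.sqrt` takes the default value `0`.
  exact measurable_of_continuousOn_of_eqOn_compl hclosed.measurableSet Mat.continuousOn_sqrt 0
    fun A hA => CFC.sqrt_of_not_nonneg hA

theorem Mat.measurable_apply : Measurable fun x : Mat p × Vec p => x.1.apply x.2 :=
  Mat.continuous_apply.measurable

theorem Mat.inner_apply_right (A : Mat p) (v w : Vec p) :
    inner ℝ v (A.apply w) = inner ℝ (Mat.apply A.transpose v) w := by
  simp only [Mat.apply, EuclideanSpace.inner_eq_star_dotProduct, star_trivial,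
    Matrix.mulVec_transpose]
  rw [dotProduct_comm, Matrix.dotProduct_mulVec, dotProduct_comm]

theorem Mat.transpose_sqrt (A : Mat p) : Matrix.transpose (CFC.sqrt A : Mat p) = CFC.sqrt A := by
  have h := (Matrix.nonneg_iff_posSemidef.mp (CFC.sqrt_nonneg A)).isHermitian
  rwa [Matrix.IsHermitian, Matrix.conjTranspose_eq_transpose_of_trivial] at h

theorem Mat.norm_sqrt_apply_sq {A : Mat p} (hA : 0 ≤ A) (v : Vec p) :
    ‖Mat.apply (CFC.sqrt A) v‖ ^ 2 = inner ℝ v (A.apply v) := by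
  rw [← real_inner_self_eq_norm_sq, Mat.inner_apply_right, Mat.transpose_sqrt, ← Mat.apply_mul,
    CFC.sqrt_mul_sqrt_self A hA, real_inner_comm]

theorem Mat.inv_sqrt_apply_sqrt_apply {A : Mat p} (hA : A.PosDef) (v : Vec p) :
    invSqrtApply A (Mat.apply (CFC.sqrt A) v) = v := by
  have hu : IsUnit (CFC.sqrt A : Mat p) :=
    (CFC.isUnit_sqrt_iff A hA.posSemidef.nonneg).mpr hA.isUnit
  have hdet := (Matrix.isUnit_iff_isUnit_det _).mp hu
  rw [invSqrtApply, ← Mat.apply_mul, Matrix.nonsing_inv_mul _ hdet, Mat.one_apply]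

theorem measurable_invSqrtApply : Measurable fun x : Mat p × Vec p => invSqrtApply x.1 x.2 :=
  Mat.measurable_apply.comp
    ((Mat.measurable_inv.comp (Mat.measurable_sqrt.comp measurable_fst)).prodMk measurable_snd)

/-! ### Change of measure and the law of `(K, Z)` -/

/-- The term `u` cancels in the difference of log likelihoods, and positivity of the densities lets
the exponential recover their ratio. -/
theorem IsLogLikelihood.lintegral_eq {Θ Ω : Type*} [MeasurableSpace Ω] {P : Θ → Measure Ω}
    {l : Θ → Ω → ℝ} (h : IsLogLikelihood P l) (hl : ∀ θ, Measurable (l θ)) (θ θ₀ : Θ)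
    {g : Ω → ENNReal} (hg : Measurable g) :
    ∫⁻ ω, g ω ∂(P θ) = ∫⁻ ω, g ω * ENNReal.ofReal (Real.exp (l θ ω - l θ₀ ω)) ∂(P θ₀) := by
  obtain ⟨lam, f, u, hf⟩ := h
  obtain ⟨hm, hpos, hP, hlog⟩ := hf θ
  obtain ⟨hm₀, hpos₀, hP₀, hlog₀⟩ := hf θ₀
  have hexp : Measurable fun ω => ENNReal.ofReal (Real.exp (l θ ω - l θ₀ ω)) :=
    (((hl θ).sub (hl θ₀)).exp).ennreal_ofReal
  rw [hP, hP₀, lintegral_withDensity_eq_lintegral_mul _ hm.ennreal_ofReal hg,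
    lintegral_withDensity_eq_lintegral_mul _ hm₀.ennreal_ofReal
      (g := fun ω => g ω * ENNReal.ofReal (Real.exp (l θ ω - l θ₀ ω))) (hg.mul hexp)]
  refine lintegral_congr_ae ?_
  filter_upwards [hpos, hpos₀, hlog, hlog₀] with ω h1 h2 h3 h4
  have : f θ ω = f θ₀ ω * Real.exp (l θ ω - l θ₀ ω) := by
    rw [h3, h4, add_sub_add_left_eq_sub, Real.exp_sub, Real.exp_log h1, Real.exp_log h2]
    field_simp
  simp only [Pi.mul_apply]
  rw [this, ENNReal.ofReal_mul h2.le]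
  ring

namespace IsLAMN

variable {Ω : Type*} [MeasurableSpace Ω] {P : Vec p → Measure Ω} {Z : Ω → Vec p} {K : Ω → Mat p}

theorem measurable_logLikelihood (h : IsLAMN P Z K) (δ : Vec p) :
    Measurable fun ω => (C2.quadratic (Z ω) (K ω)).toFun δ := by
  have h1 : Measurable fun ω => (K ω).apply δ :=
    Mat.measurable_apply.comp (h.measurable_K.prodMk measurable_const)
  exact (measurable_const.inner h.measurable_Z).sub
    (measurable_const.mul (measurable_const.inner h1))

/-- On every event determined by `K`, the Laplace transform of `Z` under `P 0` is that of `N(0, K)`. -/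
theorem setLIntegral_exp_inner (h : IsLAMN P Z K) {s : Set (Mat p)} (hs : MeasurableSet s)
    (δ : Vec p) :
    ∫⁻ ω in K ⁻¹' s, ENNReal.ofReal (Real.exp (inner ℝ δ (Z ω))) ∂(P 0) =
      ∫⁻ ω in K ⁻¹' s, ENNReal.ofReal (Real.exp (inner ℝ δ ((K ω).apply δ) / 2)) ∂(P 0) := by
  -- The weight `exp(½ δ'Kδ)` cancels the quadratic term of the likelihood ratio and leaves
  -- `exp(δ'Z)`.
  set g : Mat p → ENNReal :=
    s.indicator fun A => ENNReal.ofReal (Real.exp (inner ℝ δ (A.apply δ) / 2)) with hgdef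
  have hg : Measurable g := by
    refine Measurable.indicator ?_ hs
    have h1 : Measurable fun A : Mat p => A.apply δ :=
      Mat.measurable_apply.comp (measurable_id.prodMk measurable_const)
    exact ((measurable_const.inner h1).div_const 2).exp.ennreal_ofReal
  have h1 : ∫⁻ ω, g (K ω) ∂(P 0) = ∫⁻ ω, g (K ω) ∂(P δ) := by
    rw [← lintegral_map hg h.measurable_K, ← lintegral_map hg h.measurable_K, h.map_K_eq 0 δ]
  rw [h.isLogLikelihood.lintegral_eq h.measurable_logLikelihood δ 0
    (g := fun ω => g (K ω)) (hg.comp h.measurable_K)] at h1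
  rw [← lintegral_indicator (h.measurable_K hs), ← lintegral_indicator (h.measurable_K hs)]
  refine Eq.trans (lintegral_congr fun ω => ?_) (h1.symm.trans (lintegral_congr fun ω => ?_))
  · by_cases hω : K ω ∈ s
    · simp only [hgdef, Set.indicator, Set.mem_preimage, hω, if_true, C2.quadratic]
      rw [← ENNReal.ofReal_mul (Real.exp_pos _).le, ← Real.exp_add]
      simp only [inner_zero_left]
      ring_nf
    · simp [hgdef, Set.indicator, hω]
  · rfl

theorem measurable_sqrt_apply (h : IsLAMN P Z K) :
    Measurable fun x : Ω × Vec p => Mat.apply (CFC.sqrt (K x.1)) x.2 :=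
  Mat.measurable_apply.comp
    ((Mat.measurable_sqrt.comp (h.measurable_K.comp measurable_fst)).prodMk measurable_snd)

/-- Given `K`, the vector `K^(1/2) W` has Laplace transform `exp(½ t'Kt)`, which matches that of
`Z`. The compact set `C` is there because this exponential need not be integrable over all values of
`K`. -/
theorem map_restrict_eq (h : IsLAMN P Z K) {s C : Set (Mat p)} (hs : MeasurableSet s)
    (hC : IsCompact C) (hsC : s ⊆ C) :
    ((P 0).restrict (K ⁻¹' s)).map Z = (((P 0).restrict (K ⁻¹' s)).prod
      (stdGaussian (Vec p))).map (fun x => Mat.apply (CFC.sqrt (K x.1)) x.2) := by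
  have := h.isProbabilityMeasure 0
  have hexp (t : Vec p) : Measurable fun x : Vec p =>
    ENNReal.ofReal (Real.exp (inner ℝ t x)) := by fun_prop
  have hL (t : Vec p) :
      ∫⁻ x, ENNReal.ofReal (Real.exp (inner ℝ t x)) ∂((P 0).restrict (K ⁻¹' s)).map Z =
        ∫⁻ ω in K ⁻¹' s, ENNReal.ofReal (Real.exp (inner ℝ t ((K ω).apply t) / 2)) ∂(P 0) := by
    rw [lintegral_map (hexp t) h.measurable_Z, h.setLIntegral_exp_inner hs]
  refine Measure.ext_of_lintegral_exp_inner (fun t => ?_) (fun t => ?_)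
  · rw [hL, lintegral_map (hexp t) h.measurable_sqrt_apply,
      lintegral_prod
        (fun x : Ω × Vec p =>
          ENNReal.ofReal (Real.exp (inner ℝ t (Mat.apply (CFC.sqrt (K x.1)) x.2))))
        ((hexp t).comp h.measurable_sqrt_apply).aemeasurable]
    refine lintegral_congr_ae ?_
    filter_upwards [ae_restrict_of_ae (h.posDef 0)] with ω hω
    simp only [Mat.inner_apply_right _ t, Mat.transpose_sqrt]
    rw [lintegral_exp_inner_stdGaussian, Mat.norm_sqrt_apply_sq hω.posSemidef.nonneg,
      ← Mat.inner_apply_right]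
  · have hc : Continuous fun A : Mat p => inner ℝ t (A.apply t) / 2 :=
      (continuous_const.inner
        (Mat.continuous_apply.comp (continuous_id.prodMk continuous_const))).div_const 2
    obtain ⟨b, hb⟩ := (hC.image hc).bddAbove
    rw [hL]
    refine ne_top_of_le_ne_top (b := ENNReal.ofReal (Real.exp b) * P 0 (K ⁻¹' s))
      (ENNReal.mul_ne_top ENNReal.ofReal_ne_top (measure_ne_top _ _)) ?_
    rw [← setLIntegral_const]
    refine setLIntegral_mono' (h.measurable_K hs) fun ω hω => ?_
    gcongr
    exact hb ⟨K ω, hsC hω, rfl⟩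

/-- In a LAMN model the joint law of `(K, Z)` is that of `(K, K ^ (1/2) W)` with `W` standard normal
and independent of `K`. -/
theorem map_prodMk_eq (h : IsLAMN P Z K) :
    (P 0).map (fun ω => (K ω, Z ω)) = ((P 0).prod (stdGaussian (Vec p))).map
      (fun x => (K x.1, Mat.apply (CFC.sqrt (K x.1)) x.2)) := by
  have := h.isProbabilityMeasure 0
  have hKZ := h.measurable_K.prodMk h.measurable_Z
  have hKW : Measurable fun x : Ω × Vec p => (K x.1, Mat.apply (CFC.sqrt (K x.1)) x.2) :=
    (h.measurable_K.comp measurable_fst).prodMk h.measurable_sqrt_apply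
  have hcompact {s C : Set (Mat p)} {t : Set (Vec p)} (hs : MeasurableSet s) (ht : MeasurableSet t)
      (hC : IsCompact C) (hsC : s ⊆ C) : (P 0).map (fun ω => (K ω, Z ω)) (s ×ˢ t) =
        ((P 0).prod (stdGaussian (Vec p))).map
          (fun x => (K x.1, Mat.apply (CFC.sqrt (K x.1)) x.2)) (s ×ˢ t) := by
    have hst := congrArg (fun m => m t) (h.map_restrict_eq hs hC hsC)
    simp only at hst
    rw [Measure.map_apply h.measurable_Z ht, Measure.map_apply h.measurable_sqrt_apply ht,
      Measure.restrict_apply (h.measurable_Z ht), ← Measure.restrict_univ (μ := stdGaussian (Vec p)),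
      Measure.prod_restrict, Measure.restrict_apply (h.measurable_sqrt_apply ht)] at hst
    rw [Measure.map_apply hKZ (hs.prod ht), Measure.map_apply hKW (hs.prod ht)]
    convert hst using 2 <;> ext x <;> simp [and_comm]
  have : SigmaCompactSpace (Mat p) := inferInstanceAs (SigmaCompactSpace (Fin p → Fin p → ℝ))
  -- Rectangles determine the law; exhausting the matrices by compact sets removes the boundedness
  -- restriction.
  refine Measure.ext_prod fun {s t} hs ht => ?_
  have hunion : s ×ˢ t = ⋃ n, (s ∩ compactCovering (Mat p) n) ×ˢ t := by
    rw [← Set.iUnion_prod_const, ← Set.inter_iUnion, iUnion_compactCovering, Set.inter_univ]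
  have hmono : Monotone fun n => (s ∩ compactCovering (Mat p) n) ×ˢ t := fun m n hmn =>
    Set.prod_mono (Set.inter_subset_inter_right _ (compactCovering_subset _ hmn)) subset_rfl
  rw [hunion, hmono.measure_iUnion, hmono.measure_iUnion]
  exact iSup_congr fun n => hcompact
    (hs.inter (isCompact_compactCovering _ n).isClosed.measurableSet) ht
    (isCompact_compactCovering _ n) Set.inter_subset_right

/-- Applying `(A, z) ↦ A^(-1/2) z` to `(K, K^(1/2) W)` returns `W` almost surely. -/
theorem hasLaw_invSqrtApply (h : IsLAMN P Z K) :
    HasLaw (fun ω => invSqrtApply (K ω) (Z ω)) (stdGaussian (Vec p)) (P 0) := by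
  have := h.isProbabilityMeasure 0
  have hKZ := h.measurable_K.prodMk h.measurable_Z
  have hKW : Measurable fun x : Ω × Vec p => (K x.1, Mat.apply (CFC.sqrt (K x.1)) x.2) :=
    (h.measurable_K.comp measurable_fst).prodMk h.measurable_sqrt_apply
  refine ⟨(measurable_invSqrtApply.comp hKZ).aemeasurable, ?_⟩
  have h1 := congrArg (Measure.map fun x : Mat p × Vec p => invSqrtApply x.1 x.2) h.map_prodMk_eq
  rw [Measure.map_map measurable_invSqrtApply hKZ,
    Measure.map_map measurable_invSqrtApply hKW] at h1
  refine h1.trans (Eq.trans (b := ((P 0).prod (stdGaussian (Vec p))).map Prod.snd) ?_ (by simp))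
  refine Measure.map_congr ?_
  filter_upwards [Measure.quasiMeasurePreserving_fst.ae (h.posDef 0)] with x hx
  exact Mat.inv_sqrt_apply_sqrt_apply hx _

end IsLAMN

/-! ### Topology of `C²(ℝᵖ)` and derivatives of quadratics -/

namespace C2

/-- Provides the approximation of closed sets by continuous functions that the mapping theorem
requires. -/
instance instPseudoMetrizableSpace : TopologicalSpace.PseudoMetrizableSpace (C2 p) :=
  Topology.IsInducing.pseudoMetrizableSpace (f := jet) ⟨rfl⟩

theorem continuous_jet : Continuous (jet : C2 p → _) := continuous_induced_dom

/-- Evaluation is jointly continuous for the compact-open topology because `ℝᵖ` is locally compact.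
-/
theorem continuous_grad_uncurry : Continuous fun x : C2 p × Vec p => x.1.grad x.2 := by
  have h : Continuous fun x : C2 p × Vec p => x.1.jet.2.1 x.2 :=
    ((continuous_fst.comp continuous_snd).comp (continuous_jet.comp continuous_fst)).eval
      continuous_snd
  exact h

theorem continuous_hess_uncurry : Continuous fun x : C2 p × Vec p => x.1.hess x.2 := by
  have h : Continuous fun x : C2 p × Vec p => x.1.jet.2.2 x.2 :=
    ((continuous_snd.comp continuous_snd).comp (continuous_jet.comp continuous_fst)).eval
      continuous_snd
  exact h

theorem hess_apply (f : C2 p) (x : Vec p) (i j : Fin p) :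
    f.hess x i j = fderiv ℝ (fderiv ℝ f.toFun) x (EuclideanSpace.single i 1)
      (EuclideanSpace.single j 1) := by
  have hd : DifferentiableAt ℝ (fderiv ℝ f.toFun) x :=
    ((f.contDiff.fderiv_right (m := 1) (by norm_num)).differentiable (by norm_num)) x
  simp only [hess, hessianMatrix, Matrix.of_apply]
  rw [fderiv_clm_apply hd (by fun_prop)]
  simp

theorem isHermitian_hess (f : C2 p) (x : Vec p) : (f.hess x).IsHermitian := by
  ext i j
  rw [Matrix.conjTranspose_apply, star_trivial, hess_apply, hess_apply]
  exact (f.contDiff.contDiffAt.isSymmSndFDerivAt (by simp)) _ _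

/-- Symmetry of second derivatives holds automatically, so only the open condition on the sphere
remains. -/
theorem isOpen_setOf_posDef_neg_hess :
    IsOpen {x : C2 p × Vec p | (-x.1.hess x.2).PosDef} := by
  have h : {x : C2 p × Vec p | (-x.1.hess x.2).PosDef} = (fun x => -x.1.hess x.2) ⁻¹'
      {A : Mat p | ∀ x ∈ Metric.sphere (0 : Vec p) 1, 0 < inner ℝ x (A.apply x)} := by
    ext x
    simp only [Set.mem_ofPred_eq, Set.mem_preimage, Mat.posDef_iff,
      and_iff_right (x.1.isHermitian_hess x.2).neg]
  rw [h]
  exact Mat.isOpen_forall_quadratic_pos.preimage continuous_hess_uncurry.neg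

theorem hasFDerivAt_quadratic (z : Vec p) {K : Mat p} (hK : K.IsHermitian) (x : Vec p) :
    HasFDerivAt (quadratic z K).toFun (innerSL ℝ (z - K.apply x)) x := by
  have hl : HasFDerivAt (fun δ : Vec p => K.apply δ)
    (Matrix.toEuclideanLin K).toContinuousLinearMap x :=
    (Matrix.toEuclideanLin K).toContinuousLinearMap.hasFDerivAt
  have h := ((hasFDerivAt_id x).inner ℝ (hasFDerivAt_const z x)).sub
    (((hasFDerivAt_id x).inner ℝ hl).const_mul (1 / 2))
  refine h.congr_fderiv (ContinuousLinearMap.ext fun v => ?_)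
  have hv : inner ℝ x (K.apply v) = inner ℝ (K.apply x) v := by
    rw [Mat.inner_apply_right]
    rw [Matrix.IsHermitian, Matrix.conjTranspose_eq_transpose_of_trivial] at hK
    rw [hK]
  have hv' : (Matrix.toEuclideanLin K).toContinuousLinearMap v = K.apply v := rfl
  simp [fderivInnerCLM_apply, hv', hv, real_inner_comm]
  ring

theorem grad_quadratic (z : Vec p) {K : Mat p} (hK : K.IsHermitian) (x : Vec p) :
    (quadratic z K).grad x = z - K.apply x := by
  refine HasGradientAt.gradient ?_
  exact hasFDerivAt_quadratic z hK x

theorem hess_quadratic (z : Vec p) {K : Mat p} (hK : K.IsHermitian) (x : Vec p) :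
    (quadratic z K).hess x = -K := by
  ext i j
  have hf : fderiv ℝ (quadratic z K).toFun = fun y => innerSL ℝ (z - K.apply y) :=
    funext fun y => (hasFDerivAt_quadratic z hK y).fderiv
  have hl : HasFDerivAt (fun δ : Vec p => K.apply δ)
    (Matrix.toEuclideanLin K).toContinuousLinearMap x :=
    (Matrix.toEuclideanLin K).toContinuousLinearMap.hasFDerivAt
  have hd := ((innerSL ℝ).hasFDerivAt (x := z - K.apply x)).comp x (hl.const_sub z)
  have hd' : fderiv ℝ (fun y => innerSL ℝ (z - K.apply y)) x =
    (innerSL ℝ).comp (-(Matrix.toEuclideanLin K).toContinuousLinearMap) := hd.fderiv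
  have hs : K j i = K i j := by simpa using hK.apply i j
  rw [hess_apply, hf, hd']
  change inner ℝ (-K.apply (EuclideanSpace.single i 1)) (EuclideanSpace.single j 1) = -K i j
  rw [EuclideanSpace.inner_single_right]
  simp [Mat.apply, hs]

end C2

/-! ### Continuity and measurability of the Newton step -/

/-- The Newton update `δ + (-∇²q(δ))⁻¹ ∇q(δ)`, without the NaO convention. -/
noncomputable def newtonUpdate (x : C2 p × Vec p) : Vec p :=
  x.2 + Mat.apply (-x.1.hess x.2)⁻¹ (x.1.grad x.2)

/-- The pairs `(q, δ)` at which the observed information is positive definite. -/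
def newtonDomain (p : ℕ) : Set (C2 p × Vec p) := {x | (-x.1.hess x.2).PosDef}

/-- The pairs `(q, δ)` at which the observed information is positive definite both before and after
the Newton update. -/
def newtonDomain₂ (p : ℕ) : Set (C2 p × Vec p) :=
  newtonDomain p ∩ (fun x => (x.1, newtonUpdate x)) ⁻¹' newtonDomain p

theorem isOpen_newtonDomain : IsOpen (newtonDomain p) := C2.isOpen_setOf_posDef_neg_hess

theorem continuousOn_newtonUpdate : ContinuousOn (newtonUpdate (p := p)) (newtonDomain p) := by
  have hinv : ContinuousOn (fun x : C2 p × Vec p => ((-x.1.hess x.2)⁻¹ : Mat p))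
      (newtonDomain p) :=
    Mat.continuousOn_inv_posDef.comp C2.continuous_hess_uncurry.neg.continuousOn fun x hx => hx
  exact continuousOn_snd.add (Mat.continuous_apply.comp_continuousOn
    (hinv.prodMk C2.continuous_grad_uncurry.continuousOn))

theorem continuousOn_prodMk_newtonUpdate :
    ContinuousOn (fun x : C2 p × Vec p => (x.1, newtonUpdate x)) (newtonDomain p) :=
  continuousOn_fst.prodMk continuousOn_newtonUpdate

theorem isOpen_newtonDomain₂ : IsOpen (newtonDomain₂ p) :=
  continuousOn_prodMk_newtonUpdate.isOpen_inter_preimage isOpen_newtonDomain isOpen_newtonDomain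

theorem newtonStep_of_mem {x : C2 p × Vec p} (hx : x ∈ newtonDomain p) :
    newtonStep x.1 (NaO.obj x.2) = NaO.obj (newtonUpdate x) :=
  if_pos hx

theorem newtonStep_of_notMem {x : C2 p × Vec p} (hx : x ∉ newtonDomain p) :
    newtonStep x.1 (NaO.obj x.2) = NaO.nao :=
  if_neg hx

/-- The observed information at the one-step Newton estimator. -/
noncomputable def newtonInfo (x : C2 p × Vec p) : NaO (Mat p) :=
  obsInfo x.1 (newtonStep x.1 (NaO.obj x.2))

/-- The one-step Newton estimator standardized by the observed information. -/
noncomputable def newtonStandardized (x : C2 p × Vec p) : NaO (Vec p) :=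
  applyNaO (sqrtNaO (newtonInfo x)) (newtonStep x.1 (NaO.obj x.2))

theorem newtonInfo_of_mem {x : C2 p × Vec p} (hx : x ∈ newtonDomain p) :
    newtonInfo x = NaO.obj (-x.1.hess (newtonUpdate x)) := by
  rw [newtonInfo, newtonStep_of_mem hx]
  rfl

theorem newtonInfo_of_notMem {x : C2 p × Vec p} (hx : x ∉ newtonDomain p) :
    newtonInfo x = NaO.nao := by
  rw [newtonInfo, newtonStep_of_notMem hx]
  rfl

theorem newtonStandardized_of_mem {x : C2 p × Vec p} (hx : x ∈ newtonDomain₂ p) :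
    newtonStandardized x = NaO.obj
      (Mat.apply (CFC.sqrt (-x.1.hess (newtonUpdate x))) (newtonUpdate x)) := by
  have h : sqrtNaO (NaO.obj (-x.1.hess (newtonUpdate x))) =
    NaO.obj (CFC.sqrt (-x.1.hess (newtonUpdate x))) := if_pos hx.2
  rw [newtonStandardized, newtonInfo_of_mem hx.1, newtonStep_of_mem hx.1, h]
  rfl

/-- NaO arises in two ways: the step itself is undefined, or the square root at the updated point
is. -/
theorem newtonStandardized_of_notMem {x : C2 p × Vec p} (hx : x ∉ newtonDomain₂ p) :
    newtonStandardized x = NaO.nao := by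
  by_cases h1 : x ∈ newtonDomain p
  · have h : sqrtNaO (NaO.obj (-x.1.hess (newtonUpdate x))) = NaO.nao :=
      if_neg fun h => hx ⟨h1, h⟩
    rw [newtonStandardized, newtonInfo_of_mem h1, h]
    rfl
  · rw [newtonStandardized, newtonInfo_of_notMem h1]
    rfl

theorem continuousOn_newtonStep :
    ContinuousOn (fun x : C2 p × Vec p => newtonStep x.1 (NaO.obj x.2)) (newtonDomain p) :=
  (continuous_inl.comp_continuousOn continuousOn_newtonUpdate).congr fun _ => newtonStep_of_mem

theorem continuousOn_neg_hess_newtonUpdate :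
    ContinuousOn (fun x : C2 p × Vec p => -x.1.hess (newtonUpdate x)) (newtonDomain p) :=
  (C2.continuous_hess_uncurry.comp_continuousOn continuousOn_prodMk_newtonUpdate).neg

theorem continuousOn_newtonInfo : ContinuousOn (newtonInfo (p := p)) (newtonDomain p) :=
  (continuous_inl.comp_continuousOn continuousOn_neg_hess_newtonUpdate).congr
    fun _ => newtonInfo_of_mem

theorem continuousOn_newtonStandardized :
    ContinuousOn (newtonStandardized (p := p)) (newtonDomain₂ p) := by
  have hsqrt : ContinuousOn
      (fun x : C2 p × Vec p => (CFC.sqrt (-x.1.hess (newtonUpdate x)) : Mat p))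
      (newtonDomain₂ p) :=
    Mat.continuousOn_sqrt.comp
      (continuousOn_neg_hess_newtonUpdate.mono Set.inter_subset_left)
      fun x hx => hx.2.posSemidef.nonneg
  exact (continuous_inl.comp_continuousOn (Mat.continuous_apply.comp_continuousOn
    (hsqrt.prodMk (continuousOn_newtonUpdate.mono Set.inter_subset_left)))).congr
      fun _ => newtonStandardized_of_mem

theorem measurable_newtonStep :
    Measurable (fun x : C2 p × Vec p => newtonStep x.1 (NaO.obj x.2)) :=
  measurable_of_continuousOn_of_eqOn_compl isOpen_newtonDomain.measurableSet
    continuousOn_newtonStep NaO.nao fun _ => newtonStep_of_notMem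

theorem measurable_newtonInfo : Measurable (newtonInfo (p := p)) :=
  measurable_of_continuousOn_of_eqOn_compl isOpen_newtonDomain.measurableSet
    continuousOn_newtonInfo NaO.nao fun _ => newtonInfo_of_notMem

theorem measurable_newtonStandardized : Measurable (newtonStandardized (p := p)) :=
  measurable_of_continuousOn_of_eqOn_compl isOpen_newtonDomain₂.measurableSet
    continuousOn_newtonStandardized NaO.nao fun _ => newtonStandardized_of_notMem

/-! ### Exactness of the Newton step on quadratics -/

theorem mem_newtonDomain_quadratic {K : Mat p} (hK : K.PosDef) (z δ : Vec p) : (C2.quadratic z K, δ) ∈ newtonDomain p := by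
  change (-(C2.quadratic z K).hess δ).PosDef
  rwa [C2.hess_quadratic z hK.isHermitian, neg_neg]

theorem newtonUpdate_quadratic {K : Mat p} (hK : K.PosDef) (z δ : Vec p) :
    newtonUpdate (C2.quadratic z K, δ) = Mat.apply (K⁻¹ : Mat p) z := by
  have hdet : IsUnit K.det := (Matrix.isUnit_iff_isUnit_det _).mp hK.isUnit
  have hsub (u v : Vec p) :
      Mat.apply (K⁻¹ : Mat p) (u - v) = Mat.apply K⁻¹ u - Mat.apply K⁻¹ v := by
    simp [Mat.apply, Matrix.mulVec_sub]
  simp only [newtonUpdate]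
  rw [C2.hess_quadratic z hK.isHermitian, C2.grad_quadratic z hK.isHermitian, neg_neg, hsub,
    ← Mat.apply_mul, Matrix.nonsing_inv_mul _ hdet, Mat.one_apply, add_sub_cancel]

theorem mem_newtonDomain₂_quadratic {K : Mat p} (hK : K.PosDef) (z δ : Vec p) : (C2.quadratic z K, δ) ∈ newtonDomain₂ p :=
  ⟨mem_newtonDomain_quadratic hK z δ, mem_newtonDomain_quadratic hK z _⟩

/-- The updated point is `K⁻¹ z`, and `K^(1/2) K⁻¹ = K^(-1/2)`. -/
theorem newtonStandardized_quadratic {K : Mat p} (hK : K.PosDef) (z δ : Vec p) :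
    newtonStandardized (C2.quadratic z K, δ) = NaO.obj (invSqrtApply K z) := by
  have hu : IsUnit (CFC.sqrt K : Mat p) :=
    (CFC.isUnit_sqrt_iff K hK.posSemidef.nonneg).mpr hK.isUnit
  have hdet := (Matrix.isUnit_iff_isUnit_det _).mp hu
  have hmul : (CFC.sqrt K * K⁻¹ : Mat p) = (CFC.sqrt K)⁻¹ := by
    conv_lhs => rw [← CFC.sqrt_mul_sqrt_self K hK.posSemidef.nonneg, Matrix.mul_inv_rev,
      CFC.sqrt_mul_sqrt_self K hK.posSemidef.nonneg, Matrix.mul_nonsing_inv_cancel_left _ _ hdet]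
  rw [newtonStandardized_of_mem (mem_newtonDomain₂_quadratic hK z δ),
    C2.hess_quadratic z hK.isHermitian, neg_neg, newtonUpdate_quadratic hK, ← Mat.apply_mul, hmul,
    invSqrtApply]

/-! ### The joint limit and its marginals -/

theorem theorem2 {p : ℕ}
    {Ωn : ℕ → Type*} [∀ n, MeasurableSpace (Ωn n)]
    (μ : ∀ n, Measure (Ωn n)) [∀ n, IsProbabilityMeasure (μ n)]
    (qn : ∀ n, Ωn n → C2 p) (δn : ∀ n, Ωn n → Vec p)
    {Ω : Type*} [MeasurableSpace Ω]
    (P : Vec p → Measure Ω) [∀ δ, IsProbabilityMeasure (P δ)]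
    (Z : Ω → Vec p) (K : Ω → Mat p) (hLAMN : IsLAMN P Z K)
    (δ : Ω → Vec p)
    -- `(qₙ, δₙ)` converges in law to `(q, δ)` in `C²(ℝᵖ) × ℝᵖ`, where the limit is under the
    -- true parameter value zero
    (hconv : TendstoInDistribution (fun n ω => (qn n ω, δn n ω)) atTop
      (fun ω => (C2.quadratic (Z ω) (K ω), δ ω)) μ (P 0))
    -- the one-step Newton estimator
    (δhat : ∀ n, Ωn n → NaO (Vec p))
    (hδhat : ∀ n ω, δhat n ω = newtonStep (qn n ω) (NaO.obj (δn n ω))) :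
    TendstoInDistribution (fun n ω => -(qn n ω).hess (δn n ω)) atTop K μ (P 0) ∧
    TendstoInDistribution (fun n ω => obsInfo (qn n ω) (δhat n ω)) atTop
      (fun ω => NaO.obj (K ω)) μ (P 0) ∧
    TendstoInDistribution δhat atTop (fun ω => NaO.obj ((K ω)⁻¹.apply (Z ω))) μ (P 0) ∧
    TendstoInDistribution
      (fun n ω => applyNaO (sqrtNaO (obsInfo (qn n ω) (δhat n ω))) (δhat n ω)) atTop
      (fun x : Vec p => NaO.obj x) μ (stdGaussian (Vec p)) ∧
    -- all of these hold jointly, and in the joint limit the last component is `K ^ (-1/2) Z`,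
    -- which is standard normal
    TendstoInDistribution
      (fun n ω => (qn n ω, δn n ω, -(qn n ω).hess (δn n ω), obsInfo (qn n ω) (δhat n ω),
        δhat n ω, applyNaO (sqrtNaO (obsInfo (qn n ω) (δhat n ω))) (δhat n ω))) atTop
      (fun ω => (C2.quadratic (Z ω) (K ω), δ ω, K ω, NaO.obj (K ω),
        NaO.obj ((K ω)⁻¹.apply (Z ω)), NaO.obj (invSqrtApply (K ω) (Z ω)))) μ (P 0) ∧
    HasLaw (fun ω => invSqrtApply (K ω) (Z ω)) (stdGaussian (Vec p)) (P 0) := by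
  set Φ : C2 p × Vec p → C2 p × Vec p × Mat p × NaO (Mat p) × NaO (Vec p) × NaO (Vec p) :=
    fun x => (x.1, x.2, -x.1.hess x.2, newtonInfo x, newtonStep x.1 (NaO.obj x.2),
      newtonStandardized x) with hΦ
  have hΦm : Measurable Φ :=
    measurable_fst.prodMk <| measurable_snd.prodMk <|
      C2.continuous_hess_uncurry.neg.measurable.prodMk <| measurable_newtonInfo.prodMk <|
      measurable_newtonStep.prodMk measurable_newtonStandardized
  have hsub : newtonDomain₂ p ⊆ newtonDomain p := Set.inter_subset_left
  have hΦc : ContinuousOn Φ (newtonDomain₂ p) :=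
    continuousOn_fst.prodMk <| continuousOn_snd.prodMk <|
      C2.continuous_hess_uncurry.neg.continuousOn.prodMk <|
      (continuousOn_newtonInfo.mono hsub).prodMk <|
      (continuousOn_newtonStep.mono hsub).prodMk continuousOn_newtonStandardized
  have hlim : ∀ᵐ ω ∂(P 0), (C2.quadratic (Z ω) (K ω), δ ω) ∈ newtonDomain₂ p := by
    filter_upwards [hLAMN.posDef 0] with ω hω using mem_newtonDomain₂_quadratic hω _ _
  have hjoint : TendstoInDistribution
      (fun n ω => (qn n ω, δn n ω, -(qn n ω).hess (δn n ω), obsInfo (qn n ω) (δhat n ω),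
        δhat n ω, applyNaO (sqrtNaO (obsInfo (qn n ω) (δhat n ω))) (δhat n ω))) atTop
      (fun ω => (C2.quadratic (Z ω) (K ω), δ ω, K ω, NaO.obj (K ω),
        NaO.obj ((K ω)⁻¹.apply (Z ω)), NaO.obj (invSqrtApply (K ω) (Z ω)))) μ (P 0) := by
    refine (hconv.comp_of_continuousOn hΦm isOpen_newtonDomain₂ hΦc hlim).congr
      (fun n => ae_of_all _ fun ω => ?_) ?_
    · simp only [hδhat]
      rfl
    · filter_upwards [hLAMN.posDef 0] with ω hω
      simp only [hΦ]
      rw [newtonStandardized_quadratic hω, newtonInfo_of_mem (mem_newtonDomain_quadratic hω _ _),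
        newtonStep_of_mem (mem_newtonDomain_quadratic hω _ _), newtonUpdate_quadratic hω,
        C2.hess_quadratic _ hω.isHermitian, C2.hess_quadratic _ hω.isHermitian, neg_neg]
  have hlaw := hLAMN.hasLaw_invSqrtApply
  refine ⟨?_, ?_, ?_, ?_, hjoint, hlaw⟩
  · exact hjoint.continuous_comp (g := fun y => y.2.2.1) (by fun_prop)
  · exact hjoint.continuous_comp (g := fun y => y.2.2.2.1) (by fun_prop)
  · exact hjoint.continuous_comp (g := fun y => y.2.2.2.2.1) (by fun_prop)
  -- Convergence in law depends on the limit only through its law, so `K^(-1/2) Z` under `P 0` may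
  -- be replaced by the identity on `ℝᵖ` under the standard Gaussian.
  · have h := hjoint.continuous_comp (g := fun y => y.2.2.2.2.2) (by fun_prop)
    have hinl : Measurable fun x : Vec p => (NaO.obj x : NaO (Vec p)) := measurable_inl
    have hmap : (P 0).map (fun ω => NaO.obj (invSqrtApply (K ω) (Z ω))) =
        (stdGaussian (Vec p)).map (fun x : Vec p => NaO.obj x) := by
      rw [← hlaw.map_eq, AEMeasurable.map_map_of_aemeasurable hinl.aemeasurable hlaw.aemeasurable]
      rfl
    refine ⟨h.forall_aemeasurable, hinl.aemeasurable, ?_⟩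
    convert! h.tendsto using 2
    exact congrArg 𝓝 (Subtype.ext hmap.symm)
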